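/- **Corollary 2.10.** Let $\mathbb K=\mathbb R$ or $\mathbb K=\mathbb C$, let $V$ be a finite-dimensional $\mathbb K$-vector space with a nondegenerate hermitian form $\langle-,-\rangle$, and let $P$ be a $\mathbb K$-vector space with $\dim_{\mathbb K}P=k$. Let $M\subset\mathrm{Lin}_{\mathbb K}(P,V)$ be the open set of monomorphisms, so that $\mathrm{Gr}_{\mathbb K}(k,V)=M/\mathrm{GL}_{\mathbb K}(P)$, and let $\mathrm{Gr}^0_{\mathbb K}(k,V)$ be its open subset of subspaces on which the form is nondegenerate. Write $p$ both for a point and for a representative $p\in M$, write $p$ also for the image $pP$, and let $\pi'[p]$, $\pi[p]$ be the orthogonal projectors of $V=p\oplus p^\perp$ onto $p$ and $p^\perp$. Identify $\mathrm T_p\mathrm{Gr}^0_{\mathbb K}(k,V)=\mathrm{Lin}_{\mathbb K}(p,p^\perp)\subset\mathrm{Lin}_{\mathbb K}(V,V)$ (extension by $0$ on $p^\perp$), let $t^*$ be the adjoint of $t$ with respect to the form, and for $t\in\mathrm{Lin}_{\mathbb K}(V,V)$ put $t_p:=\pi[p]\,t\,\pi'[p]$. A tangent field over an open subset of $\mathrm{Gr}^0_{\mathbb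 K}(k,V)$, with preimage $U\subset M$, is a smooth (over $\mathbb R$) map $X:U\to\mathrm{Lin}_{\mathbb K}(V,V)$ with $X(p)_p=X(p)$ and $X(pg)=X(p)$ for all $p\in U$, $g\in\mathrm{GL}_{\mathbb K}(P)$. Equip $\mathrm{Gr}^0_{\mathbb K}(k,V)$ with the intrinsic connection $$(\nabla_YX)(p):=\Big(\tfrac{d}{d\varepsilon}\Big|_{\varepsilon=0}X\big((1+\varepsilon Y(p))p\big)\Big)_p .$$ Let $p\in\mathrm{Gr}^0_{\mathbb K}(k,V)$ and let $t,t_1,t_2:p\to p^\perp$ be tangent vectors at $p$. Then there are tangent fields $X,X_1,X_2$ over a neighbourhood of $p$ with $X(p)=t$, $X_1(p)=t_1$, $X_2(p)=t_2$, and the curvature tensor $$R(t_1,t_2)t:=\big(\nabla_{X_2}\nabla_{X_1}X-\nabla_{X_1}\nabla_{X_2}X+\nabla_{[X_1,X_2]}X\big)(p)$$ is, for every choice of such fields, $$R(t_1,t_2)t=t\,t_1^*t_2+t_2t_1^*t-t\,t_2^*t_1-t_1t_2^*t .$$ -/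

import Mathlib

open scoped ContDiff

noncomputable section

namespace GrassmannCurvature

variable {K : Type*} [RCLike K]
variable {V : Type*} [NormedAddCommGroup V] [NormedSpace K V] [FiniteDimensional K V]
variable {P : Type*} [NormedAddCommGroup P] [NormedSpace K P] [FiniteDimensional K P]

/-! `h` is a sesquilinear form on `V`, linear in its second argument.  Hermitian means `h.IsSymm`,
nondegenerate means `h.Nondegenerate`.  The norms on `V` and `P` carry no geometric content: these
spaces are finite-dimensional, and the norms only give `Lin(P, V)` and `Lin(V, V)` their usual
topology and smooth structure. -/

/-! ### Linear algebra of a nondegenerate form -/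

/-- Every system of equations `h (b i) v = c i`, `b` a basis of a subspace on which `h` is
nondegenerate, has a solution in that subspace. -/
theorem exists_mem_solution (h : V →ₗ⋆[K] V →ₗ[K] K) (W : Submodule K V)
    (hW : (h.domRestrict₁₂ W W).Nondegenerate) {ι : Type*} [Fintype ι]
    (b : Module.Basis ι K W) (c : ι → K) : ∃ v ∈ W, ∀ i, h (b i : V) v = c i := by
  classical
  let Φ : W →ₗ[K] (ι → K) := LinearMap.pi fun i => (h (b i : V)) ∘ₗ W.subtype
  have hΦ : ∀ w i, Φ w i = h (b i : V) (w : V) := fun _ _ => rfl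
  have hinj : Function.Injective Φ := by
    rw [injective_iff_map_eq_zero]
    intro w hw
    apply hW.2
    have key : ((h.domRestrict₁₂ W W).flip w) = 0 := by
      refine b.ext fun i => ?_
      simpa [LinearMap.domRestrict₁₂_apply, hΦ] using congrFun hw i
    intro x
    exact LinearMap.congr_fun key x
  have hdim : Module.finrank K W = Module.finrank K (ι → K) := by
    rw [Module.finrank_eq_card_basis b, Module.finrank_fintype_fun_eq_card]
  obtain ⟨w, hw⟩ := (LinearMap.injective_iff_surjective_of_finrank_eq_finrank hdim).1 hinj c
  exact ⟨w, w.2, fun i => by rw [← hw, hΦ]⟩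

/-- A nondegenerate subspace is complementary to its orthogonal: `V = W ⊕ W^⊥`. -/
theorem isCompl_orthogonal (h : V →ₗ⋆[K] V →ₗ[K] K) (W : Submodule K V)
    (hW : (h.domRestrict₁₂ W W).Nondegenerate) : IsCompl W (W.orthogonalBilin h) := by
  constructor
  · rw [Submodule.disjoint_def]
    intro w hw hw'
    have := hW.2 ⟨w, hw⟩ fun x => hw' x x.2
    simpa using this
  · rw [codisjoint_iff, Submodule.eq_top_iff']
    intro v
    let b := Module.finBasis K W
    obtain ⟨w, hw, hwb⟩ := exists_mem_solution h W hW b fun i => h (b i : V) v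
    refine Submodule.mem_sup.2 ⟨w, hw, v - w, ?_, by abel⟩
    intro x hx
    have key : ((h.flip (v - w)) ∘ₛₗ W.subtype) = 0 := by
      refine b.ext fun i => ?_
      simp [hwb i]
    exact LinearMap.congr_fun key ⟨x, hx⟩

theorem exists_adjoint (h : V →ₗ⋆[K] V →ₗ[K] K) (hn : h.Nondegenerate) (t : V →L[K] V) :
    ∃ s : V →L[K] V, ∀ v w, h (t v) w = h v (s w) := by
  classical
  let b := Module.finBasis K V
  let Φ : V →ₗ[K] (Fin (Module.finrank K V) → K) := LinearMap.pi fun i => h (b i)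
  have hinj : Function.Injective Φ := by
    rw [injective_iff_map_eq_zero]
    intro w hw
    apply hn.2
    have key : h.flip w = 0 := by
      refine b.ext fun i => ?_
      simpa [Φ] using congrFun hw i
    intro x
    exact LinearMap.congr_fun key x
  have hdim : Module.finrank K V = Module.finrank K (Fin (Module.finrank K V) → K) := by simp
  let e := LinearMap.linearEquivOfInjective Φ hinj hdim
  let Ψ : V →ₗ[K] (Fin (Module.finrank K V) → K) := LinearMap.pi fun i => h (t (b i))
  refine ⟨LinearMap.toContinuousLinearMap (e.symm.toLinearMap ∘ₗ Ψ), fun v w => ?_⟩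
  have hs : ∀ i, h (b i) (e.symm (Ψ w)) = h (t (b i)) w := fun i => by
    have : Φ (e.symm (Ψ w)) = Ψ w := e.apply_symm_apply (Ψ w)
    exact congrFun this i
  have key : (h.flip w) ∘ₛₗ (t : V →ₗ[K] V) = h.flip (e.symm (Ψ w)) := by
    refine b.ext fun i => ?_
    simp [hs i]
  simpa using LinearMap.congr_fun key v

open Classical in
/-- The adjoint `t^*` with respect to `h`, that is, `h (t v) w = h v (t^* w)`.  It exists and is
unique for a nondegenerate form; the value `0` is used only for degenerate forms. -/
def adjoint (h : V →ₗ⋆[K] V →ₗ[K] K) (t : V →L[K] V) : V →L[K] V :=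
  if hs : ∃ s : V →L[K] V, ∀ v w, h (t v) w = h v (s w) then hs.choose else 0

theorem adjoint_spec (h : V →ₗ⋆[K] V →ₗ[K] K) (hn : h.Nondegenerate) (t : V →L[K] V) (v w : V) :
    h (t v) w = h v (adjoint h t w) := by
  have hs := exists_adjoint h hn t
  rw [adjoint, dif_pos hs]
  exact hs.choose_spec v w

/-! ### Points and tangent vectors

A point of the grassmannian of `k`-dimensional subspaces, `k = dim P`, is represented by a
monomorphism `p : P → V`, that is, by the subspace `p P`, up to `p ↦ p ∘ g` with `g ∈ GL(P)`. -/

/-- The image `p P` of `p`, as a subspace of `V`. -/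
def image (p : P →L[K] V) : Submodule K V := LinearMap.range (p : P →ₗ[K] V)

/-- The orthogonal `p^⊥ = (p P)^⊥`. -/
def perp (h : V →ₗ⋆[K] V →ₗ[K] K) (p : P →L[K] V) : Submodule K V := (image p).orthogonalBilin h

/-- `p` represents a point of `Gr^0`: it is a monomorphism and `h` is nondegenerate on `p P`. -/
structure IsNondegeneratePoint (h : V →ₗ⋆[K] V →ₗ[K] K) (p : P →L[K] V) : Prop where
  injective : Function.Injective p
  nondegenerate : (h.domRestrict₁₂ (image p) (image p)).Nondegenerate

theorem IsNondegeneratePoint.isCompl {P : Type*} [NormedAddCommGroup P] [NormedSpace K P]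
    {h : V →ₗ⋆[K] V →ₗ[K] K} {p : P →L[K] V}
    (hp : IsNondegeneratePoint h p) : IsCompl (image p) (perp h p) :=
  isCompl_orthogonal h (image p) hp.nondegenerate

/-- The tangent space `T_p Gr^0 = Lin(p, p^⊥)`, included in `Lin(V, V)` by means of
`V = p ⊕ p^⊥`: the maps that send everything into `p^⊥` and vanish on `p^⊥`. -/
def tangentSpace (h : V →ₗ⋆[K] V →ₗ[K] K) (p : P →L[K] V) : Submodule K (V →L[K] V) where
  carrier := {t | (∀ v, t v ∈ perp h p) ∧ ∀ v ∈ perp h p, t v = 0}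
  zero_mem' := ⟨fun _ => (perp h p).zero_mem, fun _ _ => rfl⟩
  add_mem' {s t} hs ht :=
    ⟨fun v => (perp h p).add_mem (hs.1 v) (ht.1 v), fun v hv => by simp [hs.2 v hv, ht.2 v hv]⟩
  smul_mem' c t ht :=
    ⟨fun v => (perp h p).smul_mem c (ht.1 v), fun v hv => by simp [ht.2 v hv]⟩

open Classical in
/-- The map `V → P` inverse to `p` on `p P` and zero on `p^⊥` (with the value `0` if `p` does not
represent a point of `Gr^0`). -/
def coord (h : V →ₗ⋆[K] V →ₗ[K] K) (p : P →L[K] V) : V →L[K] P :=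
  if hp : IsNondegeneratePoint h p then
    LinearMap.toContinuousLinearMap
      (LinearMap.linearProjOfIsCompl (perp h p) (p : P →ₗ[K] V) hp.injective hp.isCompl)
  else 0

/-- The orthogonal projector `π'[p]` onto `p P`, along `p^⊥`. -/
def projPoint (h : V →ₗ⋆[K] V →ₗ[K] K) (p : P →L[K] V) : V →L[K] V := p ∘L coord h p

/-- The orthogonal projector `π[p]` onto `p^⊥`, along `p P`. -/
def projPerp (h : V →ₗ⋆[K] V →ₗ[K] K) (p : P →L[K] V) : V →L[K] V := 1 - projPoint h p

/-- The tangent vector `t_p = π[p] t π'[p]` at `p` given by a linear map `t : V → V`. -/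
def tangentPart (h : V →ₗ⋆[K] V →ₗ[K] K) (p : P →L[K] V) (t : V →L[K] V) : V →L[K] V :=
  projPerp h p ∘L t ∘L projPoint h p

/-- The differential at `p` of the quotient map `π` from monomorphisms to the grassmannian.  It
sends `τ ∈ T_p M = Lin(P, V)` to the tangent vector `p x ↦ π[p] (τ x)` in `Lin(p, p^⊥)`. -/
def dQuotient (h : V →ₗ⋆[K] V →ₗ[K] K) (p : P →L[K] V) (τ : P →L[K] V) : V →L[K] V :=
  projPerp h p ∘L τ ∘L coord h p

/-! ### Tangent fields, the intrinsic connection, and its curvature -/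

/-- `U` is a saturated nondegenerate open set of monomorphisms; its image in the grassmannian is an
open subset of `Gr^0`, and every open subset of `Gr^0` is such an image. -/
structure IsSaturatedNondegenerate (h : V →ₗ⋆[K] V →ₗ[K] K) (U : Set (P →L[K] V)) : Prop where
  isOpen : IsOpen U
  saturated : ∀ p ∈ U, ∀ g : P ≃L[K] P, p ∘L (g : P →L[K] P) ∈ U
  nondegenerate : ∀ p ∈ U, IsNondegeneratePoint h p

section Fields

variable [NormedSpace ℝ V] [IsScalarTower ℝ K V]

/-- `X` is a lifted field over `U`: a tangent field over the image of `U` in `Gr^0`, smooth in the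
real sense, and written as a function of representatives. -/
structure IsLiftedField (h : V →ₗ⋆[K] V →ₗ[K] K) (U : Set (P →L[K] V))
    (X : (P →L[K] V) → (V →L[K] V)) : Prop where
  smooth : ContDiffOn ℝ ∞ X U
  tangent : ∀ p ∈ U, tangentPart h p (X p) = X p
  invariant : ∀ p ∈ U, ∀ g : P ≃L[K] P, X (p ∘L (g : P →L[K] P)) = X p

/-- The intrinsic connection: `(∇_Y X)(p) = (d/dε|_{ε = 0} X ((1 + ε Y(p)) p))_p`. -/
def covDeriv (h : V →ₗ⋆[K] V →ₗ[K] K) (Y X : (P →L[K] V) → (V →L[K] V)) (p : P →L[K] V) :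
    V →L[K] V :=
  tangentPart h p (deriv (fun ε : ℝ => X ((1 + ε • Y p) ∘L p)) 0)

/-- The Lie bracket `[X, Y]` of tangent fields on `Gr^0`.  The vector fields `q ↦ X(q) q` and
`q ↦ Y(q) q` on the open set `U` of the vector space `Lin(P, V)` are mapped to `X` and `Y` by the
differential of the quotient map; hence their bracket is mapped to `[X, Y]`. -/
def bracket (h : V →ₗ⋆[K] V →ₗ[K] K) (X Y : (P →L[K] V) → (V →L[K] V)) (p : P →L[K] V) :
    V →L[K] V :=
  dQuotient h p (VectorField.lieBracket ℝ (fun q => X q ∘L q) (fun q => Y q ∘L q) p)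

/-- The curvature of the intrinsic connection on tangent fields, with the sign convention
`R(X₁, X₂) X = ∇_{X₂} ∇_{X₁} X - ∇_{X₁} ∇_{X₂} X + ∇_{[X₁, X₂]} X`. -/
def curvature (h : V →ₗ⋆[K] V →ₗ[K] K) (X₁ X₂ X : (P →L[K] V) → (V →L[K] V)) (p : P →L[K] V) :
    V →L[K] V :=
  covDeriv h X₂ (covDeriv h X₁ X) p - covDeriv h X₁ (covDeriv h X₂ X) p
    + covDeriv h (bracket h X₁ X₂) X p

end Fields

end GrassmannCurvature

end

noncomputable section

namespace GrassmannCurvature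

variable {K : Type*} [RCLike K]
variable {V : Type*} [NormedAddCommGroup V] [NormedSpace K V] [FiniteDimensional K V]
variable {P : Type*} [NormedAddCommGroup P] [NormedSpace K P]
variable {h : V →ₗ⋆[K] V →ₗ[K] K}

/-! ### The adjoint -/

/-! Everything is computed in `Lin(P, V)`, where `Q = projPoint h q` is a smooth function of `q` and
`∇_Y X = (1 - Q) dX(Y q) Q`. Differentiating `Q² = Q`, `Q^* = Q` and `Q q = q` gives `dQ(Y p) = Y +
Y^*` (`fderiv_projPoint`).

With `G = dX(X₁ q)`, the product rule turns `∇_{X₂} ∇_{X₁} X` into the tangent part of `dG(X₂ p)`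
plus `-X₂ G Q + (1 - Q) G X₂`. These corrections involve only `Q G` and `G (1 - Q)`. Differentiating
`Q X = 0` and `X Q = X` gives `Q G = -X₁^* X` and `G (1 - Q) = X X₁^*`, so the corrections are `X₂
X₁^* X + X X₁^* X₂` (`covDeriv_covDeriv`).

After antisymmetrization `d²X` cancels, and the remaining `dX` terms cancel against the bracket
term, because `dX` vanishes on vertical vectors (`fderiv_bracket`). Extensions exist because `q ↦
t_q` is a tangent field for constant `t`. -/

theorem eq_adjoint (hn : h.Nondegenerate) {t s : V →L[K] V} (hs : ∀ v w, h (t v) w = h v (s w)) :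
    adjoint h t = s := by
  ext w
  rw [← sub_eq_zero]
  refine hn.2 _ fun v => ?_
  rw [map_sub, ← hs, ← adjoint_spec h hn, sub_self]

theorem adjoint_comp (hn : h.Nondegenerate) (s t : V →L[K] V) :
    adjoint h (s ∘L t) = adjoint h t ∘L adjoint h s :=
  eq_adjoint hn fun v w => by simp [adjoint_spec h hn]

/-- The adjoint as a real-linear continuous map. -/
def adjointReal [NormedSpace ℝ V] [IsScalarTower ℝ K V] (hn : h.Nondegenerate) :
    (V →L[K] V) →L[ℝ] (V →L[K] V) :=
  haveI : FiniteDimensional ℝ (V →L[K] V) := FiniteDimensional.trans ℝ K _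
  LinearMap.toContinuousLinearMap
    { toFun := adjoint h
      map_add' := fun s t => eq_adjoint hn fun v w => by simp [adjoint_spec h hn]
      map_smul' := fun c t => eq_adjoint hn fun v w => by
        -- A real scalar acts through `algebraMap ℝ K`, and its image is fixed by conjugation. Over
        -- `K` the adjoint is only conjugate-linear.
        rw [RingHom.id_apply, smul_apply, smul_apply,
          ← algebraMap_smul K c (t v), ← algebraMap_smul K c (adjoint h t w), map_smulₛₗ, map_smul,
          LinearMap.smul_apply, adjoint_spec h hn]
        simp }

@[simp]
theorem adjointReal_apply [NormedSpace ℝ V] [IsScalarTower ℝ K V] (hn : h.Nondegenerate)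
    (t : V →L[K] V) : adjointReal hn t = adjoint h t := rfl

/-! ### The orthogonal projectors -/

omit [FiniteDimensional K V] in
theorem mem_perp {q : P →L[K] V} {v : V} : v ∈ perp h q ↔ ∀ x, h (q x) v = 0 := by
  simp [perp, image, Submodule.mem_orthogonalBilin_iff]

theorem IsNondegeneratePoint.coord_apply {q : P →L[K] V} (hq : IsNondegeneratePoint h q) (x : P) :
    coord h q (q x) = x := by
  rw [coord, dif_pos hq]
  exact LinearMap.linearProjOfIsCompl_apply_left _ (q : P →ₗ[K] V) hq.injective hq.isCompl x

theorem IsNondegeneratePoint.coord_perp {q : P →L[K] V} (hq : IsNondegeneratePoint h q) {v : V}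
    (hv : v ∈ perp h q) : coord h q v = 0 := by
  rw [coord, dif_pos hq]
  exact LinearMap.linearProjOfIsCompl_apply_right' _ (q : P →ₗ[K] V) hq.injective hq.isCompl v hv

theorem IsNondegeneratePoint.exists_add {q : P →L[K] V} (hq : IsNondegeneratePoint h q) (v : V) :
    ∃ x : P, ∃ w ∈ perp h q, v = q x + w := by
  obtain ⟨y, hy, w, hw, rfl⟩ := Submodule.mem_sup.1
    (show v ∈ image q ⊔ perp h q from hq.isCompl.sup_eq_top ▸ Submodule.mem_top)
  obtain ⟨x, rfl⟩ := hy
  exact ⟨x, w, hw, rfl⟩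

/-- Values on the summands of `V = q ⊕ q^⊥` determine an operator. Idempotence, `GL(P)`-invariance
and the explicit formula for the projector all come from this. -/
theorem IsNondegeneratePoint.eq_projPoint {q : P →L[K] V} (hq : IsNondegeneratePoint h q)
    {T : V →L[K] V} (hT : ∀ x, T (q x) = q x) (hT' : ∀ v ∈ perp h q, T v = 0) :
    T = projPoint h q := by
  ext v
  obtain ⟨x, w, hw, rfl⟩ := hq.exists_add v
  simp [projPoint, hT, hT' w hw, hq.coord_apply, hq.coord_perp hw]

theorem IsNondegeneratePoint.projPoint_apply {q : P →L[K] V} (hq : IsNondegeneratePoint h q)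
    (x : P) : projPoint h q (q x) = q x := by
  simp [projPoint, hq.coord_apply]

theorem IsNondegeneratePoint.projPoint_perp {q : P →L[K] V} (hq : IsNondegeneratePoint h q) {v : V}
    (hv : v ∈ perp h q) : projPoint h q v = 0 := by
  simp [projPoint, hq.coord_perp hv]

theorem IsNondegeneratePoint.projPoint_comp_self {q : P →L[K] V} (hq : IsNondegeneratePoint h q) :
    projPoint h q ∘L projPoint h q = projPoint h q :=
  hq.eq_projPoint (fun x => by simp [hq.projPoint_apply]) fun v hv => by simp [hq.projPoint_perp hv]

theorem IsNondegeneratePoint.projPerp_mem {q : P →L[K] V} (hq : IsNondegeneratePoint h q) (v : V) :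
    projPerp h q v ∈ perp h q := by
  obtain ⟨x, w, hw, rfl⟩ := hq.exists_add v
  simpa [projPerp, hq.projPoint_apply, hq.projPoint_perp hw] using hw

theorem IsNondegeneratePoint.coord_comp_projPoint {q : P →L[K] V}
    (hq : IsNondegeneratePoint h q) : coord h q ∘L projPoint h q = coord h q := by
  ext v
  simp [projPoint, hq.coord_apply]

/-- The cross terms between `q` and `q^⊥` vanish: in one order by definition of `perp`, in the other
by hermitian symmetry. -/
theorem IsNondegeneratePoint.adjoint_projPoint {q : P →L[K] V} (hq : IsNondegeneratePoint h q)
    (hs : h.IsSymm) (hn : h.Nondegenerate) : adjoint h (projPoint h q) = projPoint h q := by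
  refine eq_adjoint hn fun v w => ?_
  have hz : ∀ x, ∀ u ∈ perp h q, h u (q x) = 0 := fun x u hu => by
    rw [← hs.eq, mem_perp.1 hu, map_zero]
  obtain ⟨x, v', hv', rfl⟩ := hq.exists_add v
  obtain ⟨y, w', hw', rfl⟩ := hq.exists_add w
  simp [hq.projPoint_apply, hq.projPoint_perp hv', hq.projPoint_perp hw', mem_perp.1 hw', hz y v' hv']

omit [FiniteDimensional K V] in
theorem image_comp_equiv (q : P →L[K] V) (g : P ≃L[K] P) :
    image (q ∘L (g : P →L[K] P)) = image q := by
  ext v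
  constructor
  · rintro ⟨x, rfl⟩
    exact ⟨g x, rfl⟩
  · rintro ⟨x, rfl⟩
    exact ⟨g.symm x, by simp⟩

omit [FiniteDimensional K V] in
theorem IsNondegeneratePoint.comp_equiv {q : P →L[K] V} (hq : IsNondegeneratePoint h q)
    (g : P ≃L[K] P) : IsNondegeneratePoint h (q ∘L (g : P →L[K] P)) where
  injective := hq.injective.comp g.injective
  nondegenerate := by rw [image_comp_equiv]; exact hq.nondegenerate

theorem IsNondegeneratePoint.projPoint_comp_equiv {q : P →L[K] V} (hq : IsNondegeneratePoint h q)
    (g : P ≃L[K] P) : projPoint h (q ∘L (g : P →L[K] P)) = projPoint h q := by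
  refine ((hq.comp_equiv g).eq_projPoint (fun x => ?_) fun v hv => ?_).symm
  · simp [hq.projPoint_apply]
  · refine hq.projPoint_perp ?_
    rwa [perp, image_comp_equiv] at hv

theorem tangentPart_eq_of_mem {p : P →L[K] V} (hp : IsNondegeneratePoint h p) {t : V →L[K] V}
    (ht : t ∈ tangentSpace h p) : tangentPart h p t = t := by
  ext v
  obtain ⟨x, w, hw, rfl⟩ := hp.exists_add v
  simp [tangentPart, projPerp, hp.projPoint_apply, hp.projPoint_perp hw, ht.2 w hw,
    hp.projPoint_perp (ht.1 _)]

/-! ### Nondegenerate points in terms of a fixed one -/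

/-- The endomorphism `E^* E + π[p]`, where `E = q p⁻¹` on `p` and `E = 0` on `p^⊥`.  It is
invertible if and only if `q` is a nondegenerate point. -/
def gram (h : V →ₗ⋆[K] V →ₗ[K] K) (p q : P →L[K] V) : V →L[K] V :=
  adjoint h (q ∘L coord h p) ∘L (q ∘L coord h p) + projPerp h p

theorem IsNondegeneratePoint.projPoint_comp_gram {p : P →L[K] V} (hp : IsNondegeneratePoint h p)
    (hs : h.IsSymm) (hn : h.Nondegenerate) (q : P →L[K] V) :
    projPoint h p ∘L gram h p q = adjoint h (q ∘L coord h p) ∘L (q ∘L coord h p) := by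
  -- This is the adjoint of `E π'[p] = E`, the projector being self-adjoint.
  have h1 : projPoint h p ∘L adjoint h (q ∘L coord h p) = adjoint h (q ∘L coord h p) := by
    conv_lhs => rw [← hp.adjoint_projPoint hs hn, ← adjoint_comp hn,
      ContinuousLinearMap.comp_assoc, hp.coord_comp_projPoint]
  have h2 : projPoint h p ∘L projPerp h p = 0 := by
    ext v
    simp [hp.projPoint_perp (hp.projPerp_mem v)]
  rw [gram, ContinuousLinearMap.comp_add, h2, add_zero, ← ContinuousLinearMap.comp_assoc, h1]

theorem IsNondegeneratePoint.gram_apply {p : P →L[K] V} (hp : IsNondegeneratePoint h p)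
    (q : P →L[K] V) (x : P) : gram h p q (p x) = adjoint h (q ∘L coord h p) (q x) := by
  simp [gram, projPerp, hp.coord_apply, hp.projPoint_apply]

theorem isUnit_iff_injective {T : V →L[K] V} : IsUnit T ↔ Function.Injective T := by
  constructor
  · rintro ⟨u, rfl⟩ x y hxy
    have := congrArg (fun v => (↑u⁻¹ : V →L[K] V) v) hxy
    simpa [← mul_apply_eq_comp] using this
  · intro hT
    let e := (LinearEquiv.ofInjectiveEndo (T : V →ₗ[K] V) hT).toContinuousLinearEquiv
    exact ⟨ContinuousLinearEquiv.unitsEquiv K V |>.symm e, by ext v; rfl⟩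

/-- On `p^⊥` the operator is the identity. On `p` it represents the form pulled back along `q`,
since `h (q y) (q x) = h (p y) (E^* q x)`; its kernel is the radical of that pullback, which is zero
exactly when `q` is injective with nondegenerate image. -/
theorem IsNondegeneratePoint.isUnit_gram_iff {p : P →L[K] V} (hp : IsNondegeneratePoint h p)
    (hs : h.IsSymm) (hn : h.Nondegenerate) (q : P →L[K] V) :
    IsUnit (gram h p q) ↔ IsNondegeneratePoint h q := by
  rw [isUnit_iff_injective, injective_iff_map_eq_zero]
  constructor
  · intro hu
    have hinj : ∀ x, (∀ y, h (q y) (q x) = 0) → x = 0 := fun x hx => by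
      refine hp.injective ?_
      rw [map_zero]
      refine hu _ ?_
      rw [hp.gram_apply]
      refine hn.2 _ fun v => ?_
      rw [← adjoint_spec h hn]
      exact hx _
    refine ⟨(injective_iff_map_eq_zero _).2 fun x hx => hinj x fun y => by simp [hx], ?_, ?_⟩
    · rintro ⟨_, x, rfl⟩ hx
      have : x = 0 := hinj x fun y => by
        have := congrArg (starRingEnd K) (hx ⟨q y, y, rfl⟩)
        rwa [LinearMap.domRestrict₁₂_apply, hs.eq, map_zero] at this
      simp [this]
    · rintro ⟨_, x, rfl⟩ hx
      have : x = 0 := hinj x fun y => hx ⟨q y, y, rfl⟩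
      simp [this]
  · intro hq v hv
    -- Projecting to `p` isolates `E^* E v = 0` and so separates the two components of `v`.
    have h0 := DFunLike.congr_fun (hp.projPoint_comp_gram hs hn q) v
    obtain ⟨x, w, hw, rfl⟩ := hp.exists_add v
    simp only [ContinuousLinearMap.comp_apply, hv] at h0
    simp only [map_zero, map_add, hp.coord_apply, hp.coord_perp hw, add_zero] at h0
    have hx : x = 0 := by
      refine hq.injective ?_
      rw [map_zero]
      have := hq.nondegenerate.2 ⟨q x, x, rfl⟩ ?_
      · exact congrArg Subtype.val this
      rintro ⟨_, y, rfl⟩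
      have := adjoint_spec h hn (q ∘L coord h p) (p y) (q x)
      rw [← h0, map_zero] at this
      rwa [ContinuousLinearMap.comp_apply, hp.coord_apply] at this
    subst hx
    simpa [gram, projPerp, hp.coord_perp hw, hp.projPoint_perp hw] using hv

/-- This is the least-squares formula `E (E^* E)⁻¹ E^*`, with `π[p]` added to make the middle factor
invertible on all of `V`. It displays the dependence on `q` explicitly, whence smoothness. -/
theorem IsNondegeneratePoint.projPoint_eq {p q : P →L[K] V} (hp : IsNondegeneratePoint h p)
    (hq : IsNondegeneratePoint h q) (hs : h.IsSymm) (hn : h.Nondegenerate) :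
    projPoint h q = (q ∘L coord h p) ∘L Ring.inverse (gram h p q) ∘L adjoint h (q ∘L coord h p) := by
  have hu := (hp.isUnit_gram_iff hs hn q).2 hq
  refine (hq.eq_projPoint (fun x => ?_) fun v hv => ?_).symm
  · have := DFunLike.congr_fun (Ring.inverse_mul_cancel _ hu) (p x)
    simp only [mul_apply_eq_comp, one_apply_eq_self] at this
    simp only [ContinuousLinearMap.comp_apply, ← hp.gram_apply, this, hp.coord_apply]
  · have : adjoint h (q ∘L coord h p) v = 0 := hn.2 _ fun w => by
      rw [← adjoint_spec h hn]
      exact mem_perp.1 hv _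
    simp [this]

end GrassmannCurvature

end

noncomputable section

namespace GrassmannCurvature

variable {K : Type*} [RCLike K]
variable {V : Type*} [NormedAddCommGroup V] [NormedSpace K V]
variable [NormedSpace ℝ V] [IsScalarTower ℝ K V]
variable {P : Type*} [NormedAddCommGroup P] [NormedSpace K P]
variable {h : V →ₗ⋆[K] V →ₗ[K] K}

/-! ### Real calculus of composites of `K`-linear maps -/

section Composition

variable {E W : Type*} [NormedAddCommGroup E] [NormedSpace ℝ E]
  [NormedAddCommGroup W] [NormedSpace K W]

/-- Composition of `K`-linear maps as a real-bilinear map. -/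
def compReal (K V W : Type*) [RCLike K] [NormedAddCommGroup V] [NormedSpace K V] [NormedSpace ℝ V]
    [IsScalarTower ℝ K V] [NormedAddCommGroup W] [NormedSpace K W] :
    (V →L[K] V) →L[ℝ] (W →L[K] V) →L[ℝ] (W →L[K] V) :=
  (ContinuousLinearMap.compL K W V V).bilinearRestrictScalars ℝ

theorem contDiffAt_comp {n : WithTop ℕ∞} {A : E → V →L[K] V} {B : E → W →L[K] V} {x : E}
    (hA : ContDiffAt ℝ n A x) (hB : ContDiffAt ℝ n B x) :
    ContDiffAt ℝ n (fun y => A y ∘L B y) x :=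
  (compReal K V W).isBoundedBilinearMap.contDiff.contDiffAt.comp x (hA.prodMk hB)

theorem differentiableAt_comp {A : E → V →L[K] V} {B : E → W →L[K] V} {x : E}
    (hA : DifferentiableAt ℝ A x) (hB : DifferentiableAt ℝ B x) :
    DifferentiableAt ℝ (fun y => A y ∘L B y) x :=
  ((compReal K V W).hasFDerivAt_of_bilinear hA.hasFDerivAt hB.hasFDerivAt).differentiableAt

theorem fderiv_comp_apply {A : E → V →L[K] V} {B : E → W →L[K] V} {x : E}
    (hA : DifferentiableAt ℝ A x) (hB : DifferentiableAt ℝ B x) (v : E) :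
    fderiv ℝ (fun y => A y ∘L B y) x v = fderiv ℝ A x v ∘L B x + A x ∘L fderiv ℝ B x v := by
  have := DFunLike.congr_fun ((compReal K V W).fderiv_of_bilinear hA hB) v
  refine Eq.trans this ?_
  rw [add_comm]
  rfl

/-- Precomposition with `c` as a real-linear map. -/
def precompReal (V : Type*) [NormedAddCommGroup V] [NormedSpace K V] [NormedSpace ℝ V]
    [IsScalarTower ℝ K V] (c : W →L[K] P) : (P →L[K] V) →L[ℝ] (W →L[K] V) :=
  ((ContinuousLinearMap.compL K W P V).flip c).restrictScalars ℝ

end Composition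

/-! ### Smoothness and the derivative of the projectors -/

variable [FiniteDimensional K V]

theorem contDiff_gram (hn : h.Nondegenerate) (p : P →L[K] V) : ContDiff ℝ ∞ (gram h p) := by
  refine contDiff_iff_contDiffAt.2 fun q => ?_
  have hE : ContDiffAt ℝ ∞ (fun q : P →L[K] V => q ∘L coord h p) q :=
    (precompReal V (coord h p)).contDiff.contDiffAt
  exact (contDiffAt_comp ((adjointReal hn).contDiff.contDiffAt.comp q hE) hE).add contDiffAt_const

theorem isOpen_setOf_isNondegeneratePoint (hs : h.IsSymm) (hn : h.Nondegenerate) :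
    IsOpen {q : P →L[K] V | IsNondegeneratePoint h q} := by
  have := FiniteDimensional.complete K (V →L[K] V)
  -- The criterion by `gram` needs a nondegenerate base point, and any one serves for all `q`.
  by_cases hP : ∃ p : P →L[K] V, IsNondegeneratePoint h p
  · obtain ⟨p, hp⟩ := hP
    rw [← Set.ext fun q => hp.isUnit_gram_iff hs hn q]
    exact Units.isOpen.preimage (contDiff_gram hn p).continuous
  · convert isOpen_empty
    ext q
    simpa using fun hq => hP ⟨q, hq⟩

theorem IsNondegeneratePoint.eventually {p : P →L[K] V} (hp : IsNondegeneratePoint h p)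
    (hs : h.IsSymm) (hn : h.Nondegenerate) : ∀ᶠ q in nhds p, IsNondegeneratePoint h q :=
  (isOpen_setOf_isNondegeneratePoint hs hn).mem_nhds hp

theorem IsNondegeneratePoint.contDiffAt_projPoint {p : P →L[K] V} (hp : IsNondegeneratePoint h p)
    (hs : h.IsSymm) (hn : h.Nondegenerate) : ContDiffAt ℝ ∞ (projPoint h : _ → V →L[K] V) p := by
  have := FiniteDimensional.complete K (V →L[K] V)
  have hE : ContDiffAt ℝ ∞ (fun q : P →L[K] V => q ∘L coord h p) p :=
    (precompReal V (coord h p)).contDiff.contDiffAt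
  have hI : ContDiffAt ℝ ∞ (fun q => Ring.inverse (gram h p q)) p := by
    obtain ⟨u, hu⟩ := (hp.isUnit_gram_iff hs hn p).2 hp
    -- Inversion is smooth over `K`, but `gram` contains the adjoint and is treated as smooth over
    -- `ℝ`.
    have := (contDiffAt_ringInverse K (n := ∞) u).restrict_scalars ℝ
    rw [hu] at this
    exact this.comp p (contDiff_gram hn p).contDiffAt
  have key := contDiffAt_comp hE
    (contDiffAt_comp hI ((adjointReal hn).contDiff.contDiffAt.comp p hE))
  refine key.congr_of_eventuallyEq ?_
  filter_upwards [hp.eventually hs hn] with q hq using hp.projPoint_eq hq hs hn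

theorem IsNondegeneratePoint.differentiableAt_projPoint {p : P →L[K] V}
    (hp : IsNondegeneratePoint h p) (hs : h.IsSymm) (hn : h.Nondegenerate) :
    DifferentiableAt ℝ (projPoint h : _ → V →L[K] V) p :=
  (hp.contDiffAt_projPoint hs hn).differentiableAt (by simp)

/-- Differentiating `Q² = Q`, `Q^* = Q` and `Q q = q` gives `D = D Q + Q D`, `D^* = D` and `D Q =
Y`; hence `Q D = (D Q)^* = Y^*`. -/
theorem IsNondegeneratePoint.fderiv_projPoint {p : P →L[K] V} (hp : IsNondegeneratePoint h p)
    (hs : h.IsSymm) (hn : h.Nondegenerate) {Y : V →L[K] V} (hY : tangentPart h p Y = Y) :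
    fderiv ℝ (projPoint h) p (Y ∘L p) = Y + adjoint h Y := by
  have hd := hp.differentiableAt_projPoint hs hn
  set D := fderiv ℝ (projPoint h) p (Y ∘L p) with hD
  have hQ := hp.projPoint_comp_self
  have hidem : D = D ∘L projPoint h p + projPoint h p ∘L D := by
    rw [hD, ← fderiv_comp_apply hd hd]
    congr 1
    refine Filter.EventuallyEq.fderiv_eq ?_
    filter_upwards [hp.eventually hs hn] with q hq using hq.projPoint_comp_self.symm
  have hadj : adjoint h D = D := by
    have h1 := (adjointReal hn).hasFDerivAt.comp p hd.hasFDerivAt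
    have h2 : (adjointReal hn ∘ projPoint h) =ᶠ[nhds p] projPoint h := by
      filter_upwards [hp.eventually hs hn] with q hq using hq.adjoint_projPoint hs hn
    exact (DFunLike.congr_fun (h1.congr_of_eventuallyEq h2.symm).fderiv (Y ∘L p)).symm
  have hE : HasFDerivAt (fun q : P →L[K] V => q ∘L coord h p) (precompReal V (coord h p)) p :=
    (precompReal V (coord h p)).hasFDerivAt
  have hfix : D ∘L projPoint h p + projPoint h p ∘L Y ∘L projPoint h p
      = Y ∘L projPoint h p := by
    have h1 := fderiv_comp_apply hd hE.differentiableAt (Y ∘L p)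
    -- The coordinate map is frozen at `p`, so the right side is linear in `q`.
    have h2 : (fun q => projPoint h q ∘L q ∘L coord h p) =ᶠ[nhds p] fun q => q ∘L coord h p := by
      filter_upwards [hp.eventually hs hn] with q hq
      ext v
      simp [hq.projPoint_apply]
    rw [h2.fderiv_eq, hE.fderiv] at h1
    exact h1.symm
  have hYl : projPoint h p ∘L Y = 0 := by
    ext v
    rw [← hY]
    simp [tangentPart, hp.projPoint_perp (hp.projPerp_mem _)]
  have hYr : Y ∘L projPoint h p = Y := by
    rw [← hY, tangentPart, ContinuousLinearMap.comp_assoc, ContinuousLinearMap.comp_assoc, hQ]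
  have hDr : D ∘L projPoint h p = Y := by
    rwa [← ContinuousLinearMap.comp_assoc, hYl, ContinuousLinearMap.zero_comp, add_zero, hYr]
      at hfix
  have hDl : projPoint h p ∘L D = adjoint h Y := by
    rw [← hDr, adjoint_comp hn, hadj, hp.adjoint_projPoint hs hn]
  rw [hidem, hDr, hDl]

end GrassmannCurvature

end

noncomputable section

namespace GrassmannCurvature

variable {K : Type*} [RCLike K]
variable {V : Type*} [NormedAddCommGroup V] [NormedSpace K V] [FiniteDimensional K V]
variable {P : Type*} [NormedAddCommGroup P] [NormedSpace K P]
variable {h : V →ₗ⋆[K] V →ₗ[K] K}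

/-! ### Tangent vectors as elements of the endomorphism ring -/

theorem tangentPart_eq_mul (p : P →L[K] V) (t : V →L[K] V) :
    tangentPart h p t = (1 - projPoint h p) * t * projPoint h p := rfl

theorem IsNondegeneratePoint.isIdempotentElem_projPoint {p : P →L[K] V}
    (hp : IsNondegeneratePoint h p) : projPoint h p * projPoint h p = projPoint h p :=
  hp.projPoint_comp_self

theorem IsNondegeneratePoint.mul_projPoint {p : P →L[K] V} (hp : IsNondegeneratePoint h p)
    {t : V →L[K] V} (ht : tangentPart h p t = t) : t * projPoint h p = t := by
  rw [← ht, tangentPart_eq_mul, mul_assoc, hp.isIdempotentElem_projPoint]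

theorem IsNondegeneratePoint.projPoint_mul {p : P →L[K] V} (hp : IsNondegeneratePoint h p)
    {t : V →L[K] V} (ht : tangentPart h p t = t) : projPoint h p * t = 0 := by
  rw [← ht, tangentPart_eq_mul, ← mul_assoc, ← mul_assoc, mul_sub, mul_one,
    hp.isIdempotentElem_projPoint, sub_self, zero_mul, zero_mul]

theorem IsNondegeneratePoint.tangentPart_tangentPart {p : P →L[K] V}
    (hp : IsNondegeneratePoint h p) (t : V →L[K] V) :
    tangentPart h p (tangentPart h p t) = tangentPart h p t := by
  have hQ := hp.isIdempotentElem_projPoint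
  simp only [tangentPart_eq_mul]
  rw [mul_assoc, mul_assoc _ _ (projPoint h p), hQ, mul_assoc, ← mul_assoc,
    show (1 - projPoint h p) * (1 - projPoint h p) = 1 - projPoint h p by
      simp [mul_sub, sub_mul, hQ]]

theorem IsNondegeneratePoint.projPoint_mul_adjoint {p : P →L[K] V} (hp : IsNondegeneratePoint h p)
    (hs : h.IsSymm) (hn : h.Nondegenerate) {t : V →L[K] V} (ht : tangentPart h p t = t) :
    projPoint h p * adjoint h t = adjoint h t := by
  conv_rhs => rw [← hp.mul_projPoint ht]
  exact ((adjoint_comp hn _ _).trans (by rw [hp.adjoint_projPoint hs hn]; rfl)).symm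

variable [NormedSpace ℝ V] [IsScalarTower ℝ K V]

theorem IsNondegeneratePoint.adjoint_mul_projPoint {p : P →L[K] V} (hp : IsNondegeneratePoint h p)
    (hs : h.IsSymm) (hn : h.Nondegenerate) {t : V →L[K] V} (ht : tangentPart h p t = t) :
    adjoint h t * projPoint h p = 0 := by
  have h1 : adjoint h (projPoint h p ∘L t) = adjoint h t ∘L projPoint h p := by
    rw [adjoint_comp hn, hp.adjoint_projPoint hs hn]
  rw [show projPoint h p ∘L t = 0 from hp.projPoint_mul ht, ← adjointReal_apply hn, map_zero] at h1
  exact h1.symm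

/-! ### Derivatives of fields -/

omit [FiniteDimensional K V] in
-- The curve is the affine line `p + ε Y p` in `Lin(P, V)`.
theorem deriv_curve {X : (P →L[K] V) → V →L[K] V} {p : P →L[K] V} (hX : DifferentiableAt ℝ X p)
    (Y : V →L[K] V) : deriv (fun ε : ℝ => X ((1 + ε • Y) ∘L p)) 0 = fderiv ℝ X p (Y ∘L p) := by
  rw [← hX.lineDeriv_eq_fderiv, lineDeriv]
  rfl

omit [FiniteDimensional K V] in
/-- The differential of an invariant map vanishes on vertical vectors. -/
theorem fderiv_vertical [FiniteDimensional K P] {X : (P →L[K] V) → V →L[K] V} {p : P →L[K] V}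
    (hX : DifferentiableAt ℝ X p) (hinv : ∀ g : P ≃L[K] P, X (p ∘L (g : P →L[K] P)) = X p)
    (A : P →L[K] P) : fderiv ℝ X p (p ∘L A) = 0 := by
  have := FiniteDimensional.complete K P
  have hc : Continuous fun ε : ℝ => (1 + (ε : K) • A : P →L[K] P) := by fun_prop
  have hu : ∀ᶠ ε : ℝ in nhds 0, IsUnit (1 + (ε : K) • A : P →L[K] P) :=
    hc.continuousAt.eventually (Units.isOpen.mem_nhds (by simp))
  rw [← hX.lineDeriv_eq_fderiv, lineDeriv]
  -- The line `p (1 + ε A)` stays in one `GL(P)`-orbit while `1 + ε A` is invertible.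
  have hconst : (fun ε : ℝ => X (p + ε • (p ∘L A))) =ᶠ[nhds 0] fun _ => X p := by
    filter_upwards [hu] with ε hε
    obtain ⟨u, hu⟩ := hε
    rw [← hinv (ContinuousLinearEquiv.unitsEquiv K P u)]
    congr 1
    ext x
    have hx : u.val x = x + (ε : K) • A x := by rw [hu]; rfl
    have hx' : (p ∘L ((ContinuousLinearEquiv.unitsEquiv K P u : P ≃L[K] P) : P →L[K] P)) x
        = p (u.val x) := rfl
    rw [hx', hx, map_add, map_smul, ← algebraMap_smul K ε (p ∘L A)]
    rfl
  rw [hconst.deriv_eq, deriv_const]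

/-! ### Lifted fields: non-tangential components of the derivative, and curvature. -/

variable {U : Set (P →L[K] V)} {X X₁ X₂ : (P →L[K] V) → V →L[K] V} {p : P →L[K] V}

theorem IsLiftedField.contDiffAt (hX : IsLiftedField h U X) (hU : IsOpen U) (hp : p ∈ U) :
    ContDiffAt ℝ ∞ X p :=
  hX.smooth.contDiffAt (hU.mem_nhds hp)

theorem IsLiftedField.differentiableAt (hX : IsLiftedField h U X) (hU : IsOpen U) (hp : p ∈ U) :
    DifferentiableAt ℝ X p :=
  (hX.contDiffAt hU hp).differentiableAt (by simp)

theorem IsLiftedField.differentiableAt_comp (hX : IsLiftedField h U X) (hU : IsOpen U)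
    (hp : p ∈ U) : DifferentiableAt ℝ (fun q => X q ∘L q) p :=
  GrassmannCurvature.differentiableAt_comp (hX.differentiableAt hU hp) differentiableAt_id

theorem IsLiftedField.differentiableAt_fderiv (hX : IsLiftedField h U X) (hU : IsOpen U)
    (hp : p ∈ U) : DifferentiableAt ℝ (fderiv ℝ X) p :=
  ((hX.contDiffAt hU hp).fderiv_right (m := 1) (by norm_cast)).differentiableAt (by simp)

theorem IsLiftedField.covDeriv_eq (hX : IsLiftedField h U X) (hU : IsOpen U) (hp : p ∈ U)
    (Y : (P →L[K] V) → V →L[K] V) :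
    covDeriv h Y X p = tangentPart h p (fderiv ℝ X p (Y p ∘L p)) := by
  rw [covDeriv, deriv_curve (hX.differentiableAt hU hp)]

/-- Differentiate `Q X = 0`; the term `Y X` drops out because `X` takes values in `p^⊥`, where `Y`
vanishes. -/
theorem IsLiftedField.projPoint_mul_fderiv (hX : IsLiftedField h U X)
    (hU : IsSaturatedNondegenerate h U) (hp : p ∈ U) (hs : h.IsSymm) (hn : h.Nondegenerate)
    {Y : V →L[K] V} (hY : tangentPart h p Y = Y) :
    projPoint h p * fderiv ℝ X p (Y ∘L p) = -(adjoint h Y * X p) := by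
  have hpn := hU.nondegenerate p hp
  have h1 := fderiv_comp_apply (hpn.differentiableAt_projPoint hs hn)
    (hX.differentiableAt hU.isOpen hp) (Y ∘L p)
  have h2 : (fun q => projPoint h q ∘L X q) =ᶠ[nhds p] fun _ => 0 := by
    filter_upwards [hU.isOpen.mem_nhds hp] with q hq
    exact (hU.nondegenerate q hq).projPoint_mul (hX.tangent q hq)
  have h3 : Y * X p = 0 := by
    rw [← hpn.mul_projPoint hY, mul_assoc, hpn.projPoint_mul (hX.tangent p hp), mul_zero]
  rw [h2.fderiv_eq, hpn.fderiv_projPoint hs hn hY] at h1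
  replace h1 : 0 = (Y + adjoint h Y) * X p + projPoint h p * fderiv ℝ X p (Y ∘L p) := by
    refine Eq.trans ?_ h1
    rw [fderiv_const_apply, zero_apply]
  rw [add_mul, h3, zero_add] at h1
  exact eq_neg_of_add_eq_zero_right h1.symm

/-- Differentiate `X Q = X`; here `X Y = 0` for the same reason with the roles exchanged. -/
theorem IsLiftedField.fderiv_eq_mul_projPoint_add (hX : IsLiftedField h U X)
    (hU : IsSaturatedNondegenerate h U) (hp : p ∈ U) (hs : h.IsSymm) (hn : h.Nondegenerate)
    {Y : V →L[K] V} (hY : tangentPart h p Y = Y) :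
    fderiv ℝ X p (Y ∘L p) = fderiv ℝ X p (Y ∘L p) * projPoint h p + X p * adjoint h Y := by
  have hpn := hU.nondegenerate p hp
  have h1 := fderiv_comp_apply (hX.differentiableAt hU.isOpen hp)
    (hpn.differentiableAt_projPoint hs hn) (Y ∘L p)
  have h2 : (fun q => X q ∘L projPoint h q) =ᶠ[nhds p] X := by
    filter_upwards [hU.isOpen.mem_nhds hp] with q hq
    exact (hU.nondegenerate q hq).mul_projPoint (hX.tangent q hq)
  have h3 : X p * Y = 0 := by
    rw [← hpn.mul_projPoint (hX.tangent p hp), mul_assoc, hpn.projPoint_mul hY, mul_zero]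
  rw [h2.fderiv_eq, hpn.fderiv_projPoint hs hn hY] at h1
  refine h1.trans ?_
  change _ * _ + X p * (Y + adjoint h Y) = _
  rw [mul_add, h3, zero_add]

/-- The second covariant derivative in terms of the ordinary second derivative. -/
theorem covDeriv_covDeriv (hU : IsSaturatedNondegenerate h U) (hp : p ∈ U) (hs : h.IsSymm)
    (hn : h.Nondegenerate) (hX : IsLiftedField h U X) (hX₁ : IsLiftedField h U X₁)
    (hX₂ : IsLiftedField h U X₂) :
    covDeriv h X₂ (covDeriv h X₁ X) p =
      tangentPart h p (fderiv ℝ (fun q => fderiv ℝ X q (X₁ q ∘L q)) p (X₂ p ∘L p))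
        + X₂ p * adjoint h (X₁ p) * X p + X p * adjoint h (X₁ p) * X₂ p := by
  have hpn := hU.nondegenerate p hp
  have ht := hX.tangent p hp
  have ht₁ := hX₁.tangent p hp
  have ht₂ := hX₂.tangent p hp
  set G : (P →L[K] V) → V →L[K] V := fun q => fderiv ℝ X q (X₁ q ∘L q) with hG
  have hGd : DifferentiableAt ℝ G p :=
    (hX.differentiableAt_fderiv hU.isOpen hp).clm_apply (hX₁.differentiableAt_comp hU.isOpen hp)
  have hcov : covDeriv h X₁ X =ᶠ[nhds p]
      fun q => (1 - projPoint h q) ∘L (G q ∘L projPoint h q) := by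
    filter_upwards [hU.isOpen.mem_nhds hp] with q hq
    exact hX.covDeriv_eq hU.isOpen hq X₁
  have hQd := hpn.differentiableAt_projPoint hs hn
  have hRd : DifferentiableAt ℝ (fun q : P →L[K] V => 1 - projPoint h q) p := hQd.const_sub 1
  have hGQ := differentiableAt_comp hGd hQd
  have hcd : DifferentiableAt ℝ (covDeriv h X₁ X) p :=
    (differentiableAt_comp hRd hGQ).congr_of_eventuallyEq hcov
  have hD := hpn.fderiv_projPoint hs hn ht₂
  rw [covDeriv, deriv_curve hcd, hcov.fderiv_eq, fderiv_comp_apply hRd hGQ,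
    fderiv_comp_apply hGd hQd, fderiv_const_sub, neg_apply, hD]
  set S := fderiv ℝ G p (X₂ p ∘L p)
  set Q := projPoint h p
  set a₁ := adjoint h (X₁ p)
  set a₂ := adjoint h (X₂ p)
  have hQQ : Q * Q = Q := hpn.isIdempotentElem_projPoint
  have hQX : Q * X p = 0 := hpn.projPoint_mul ht
  have hQX₂ : Q * X₂ p = 0 := hpn.projPoint_mul ht₂
  have hXQ : X p * Q = X p := hpn.mul_projPoint ht
  have hX₂Q : X₂ p * Q = X₂ p := hpn.mul_projPoint ht₂
  have hQa : Q * a₂ = a₂ := hpn.projPoint_mul_adjoint hs hn ht₂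
  have haQ : a₂ * Q = 0 := hpn.adjoint_mul_projPoint hs hn ht₂
  have hQG : Q * G p = -(a₁ * X p) := hX.projPoint_mul_fderiv hU hp hs hn ht₁
  have hGQ : G p = G p * Q + X p * a₁ := hX.fderiv_eq_mul_projPoint_add hU hp hs hn ht₁
  change (1 - Q) * (-(X₂ p + a₂) * (G p * Q) + (1 - Q) * (S * Q + G p * (X₂ p + a₂))) * Q
    = (1 - Q) * S * Q + _ + _
  have e1 : (1 - Q) * (X₂ p + a₂) = X₂ p := by
    rw [sub_mul, one_mul, mul_add, hQX₂, hQa, zero_add, add_sub_cancel_right]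
  have e2 : (X₂ p + a₂) * Q = X₂ p := by rw [add_mul, hX₂Q, haQ, add_zero]
  have e3 : (1 - Q) * (1 - Q) = 1 - Q := by simp [mul_sub, sub_mul, hQQ]
  have e4 : (1 - Q) * X p = X p := by rw [sub_mul, one_mul, hQX, sub_zero]
  -- Since `X₂ = X₂ Q`, only the component `Q G` enters, and it contains no derivative of `X`.
  have e5 : X₂ p * G p * Q = -(X₂ p * a₁ * X p) := by
    rw [← hX₂Q, mul_assoc (X₂ p), hQG, hX₂Q, mul_neg, neg_mul, mul_assoc, mul_assoc, hXQ, mul_assoc]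
  -- Since `Q X₂ = 0`, only the part `X a₁` of `G` survives.
  have e6 : (1 - Q) * G p * X₂ p = X p * a₁ * X₂ p := by
    rw [hGQ, mul_assoc, add_mul, mul_assoc _ Q, hQX₂, mul_zero, zero_add, ← mul_assoc, ← mul_assoc,
      e4]
  calc _ = -((1 - Q) * (X₂ p + a₂)) * G p * (Q * Q)
        + ((1 - Q) * (1 - Q)) * S * (Q * Q)
        + ((1 - Q) * (1 - Q)) * G p * ((X₂ p + a₂) * Q) := by noncomm_ring
    _ = -(X₂ p * G p * Q) + (1 - Q) * S * Q + (1 - Q) * G p * X₂ p := by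
      rw [e1, e2, e3, hQQ, neg_mul, neg_mul]
    _ = _ := by rw [e5, e6, neg_neg]; abel

/-- Passing to the quotient removes from the bracket in `Lin(P, V)` a vertical vector `p A`, which
`dX` does not see. -/
theorem fderiv_bracket [FiniteDimensional K P] (hU : IsSaturatedNondegenerate h U) (hp : p ∈ U)
    (hX : IsLiftedField h U X) :
    fderiv ℝ X p (bracket h X₁ X₂ p ∘L p) =
      fderiv ℝ X p (fderiv ℝ (fun q => X₂ q ∘L q) p (X₁ p ∘L p))
        - fderiv ℝ X p (fderiv ℝ (fun q => X₁ q ∘L q) p (X₂ p ∘L p)) := by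
  have hpn := hU.nondegenerate p hp
  rw [← map_sub]
  set L := fderiv ℝ (fun q => X₂ q ∘L q) p (X₁ p ∘L p)
    - fderiv ℝ (fun q => X₁ q ∘L q) p (X₂ p ∘L p) with hL
  have hb : bracket h X₁ X₂ p ∘L p = L - p ∘L (coord h p ∘L L) := by
    rw [bracket, VectorField.lieBracket_eq]
    ext x
    simp [dQuotient, hpn.coord_apply, projPerp, projPoint, ← hL]
  rw [hb, map_sub, fderiv_vertical (hX.differentiableAt hU.isOpen hp) (hX.invariant p hp), sub_zero]

/-- Symmetry of `d²X` and the bracket term remove all derivatives, leaving the algebraic corrections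
of `covDeriv_covDeriv`. -/
theorem curvature_eq [FiniteDimensional K P] (hU : IsSaturatedNondegenerate h U) (hp : p ∈ U)
    (hs : h.IsSymm) (hn : h.Nondegenerate) (hX : IsLiftedField h U X)
    (hX₁ : IsLiftedField h U X₁) (hX₂ : IsLiftedField h U X₂) :
    curvature h X₁ X₂ X p =
      X p * adjoint h (X₁ p) * X₂ p + X₂ p * adjoint h (X₁ p) * X p
        - X p * adjoint h (X₂ p) * X₁ p - X₁ p * adjoint h (X₂ p) * X p := by
  have hsnd : ∀ Y Z : (P →L[K] V) → V →L[K] V, IsLiftedField h U Y →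
      fderiv ℝ (fun q => fderiv ℝ X q (Y q ∘L q)) p (Z p ∘L p) =
        fderiv ℝ (fderiv ℝ X) p (Z p ∘L p) (Y p ∘L p)
          + fderiv ℝ X p (fderiv ℝ (fun q => Y q ∘L q) p (Z p ∘L p)) := fun Y Z hY => by
    rw [fderiv_clm_apply (hX.differentiableAt_fderiv hU.isOpen hp)
      (hY.differentiableAt_comp hU.isOpen hp)]
    simp [add_comm]
  have hsym : fderiv ℝ (fderiv ℝ X) p (X₂ p ∘L p) (X₁ p ∘L p)
      = fderiv ℝ (fderiv ℝ X) p (X₁ p ∘L p) (X₂ p ∘L p) :=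
    ((hX.contDiffAt hU.isOpen hp).isSymmSndFDerivAt
      (minSmoothness_of_isRCLikeNormedField.trans_le ENat.LEInfty.out)).eq _ _
  rw [curvature, covDeriv_covDeriv hU hp hs hn hX hX₁ hX₂,
    covDeriv_covDeriv hU hp hs hn hX hX₂ hX₁, hX.covDeriv_eq hU.isOpen hp,
    fderiv_bracket hU hp hX, hsnd X₁ X₂ hX₁, hsnd X₂ X₁ hX₂, hsym]
  simp only [tangentPart_eq_mul]
  noncomm_ring

/-! ### Extension of tangent vectors to fields -/

theorem isSaturatedNondegenerate_setOf (hs : h.IsSymm) (hn : h.Nondegenerate) :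
    IsSaturatedNondegenerate h {q : P →L[K] V | IsNondegeneratePoint h q} where
  isOpen := isOpen_setOf_isNondegeneratePoint hs hn
  saturated _ hq g := IsNondegeneratePoint.comp_equiv hq g
  nondegenerate _ hq := hq

/-- The field depends on `q` only through the projector, which is smooth and `GL(P)`-invariant. -/
theorem isLiftedField_tangentPart (hs : h.IsSymm) (hn : h.Nondegenerate) (t : V →L[K] V) :
    IsLiftedField h {q : P →L[K] V | IsNondegeneratePoint h q} fun q => tangentPart h q t where
  smooth q hq := by
    have hQ := IsNondegeneratePoint.contDiffAt_projPoint hq hs hn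
    exact (contDiffAt_comp (contDiffAt_const.sub hQ)
      (contDiffAt_comp contDiffAt_const hQ)).contDiffWithinAt
  tangent _ hq := IsNondegeneratePoint.tangentPart_tangentPart hq t
  invariant _ hq g := by
    simp only [tangentPart_eq_mul, IsNondegeneratePoint.projPoint_comp_equiv hq g]

end GrassmannCurvature

end

/-- At a point `p` of `Gr^0` let `t₁, t₂, t` be tangent vectors.  They extend to tangent fields on
an open neighbourhood of `p`, and for all such extensions the value at `p` of the curvature
`R(X₁, X₂) X` of the intrinsic connection is
`t t₁^* t₂ + t₂ t₁^* t - t t₂^* t₁ - t₁ t₂^* t`. -/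
theorem corollary2p10 {K : Type*} [RCLike K]
    {V : Type*} [NormedAddCommGroup V] [NormedSpace K V] [FiniteDimensional K V]
    [NormedSpace ℝ V] [IsScalarTower ℝ K V]
    {P : Type*} [NormedAddCommGroup P] [NormedSpace K P] [FiniteDimensional K P]
    (h : V →ₗ⋆[K] V →ₗ[K] K) (hsymm : h.IsSymm) (hnondeg : h.Nondegenerate)
    (p : P →L[K] V) (hp : GrassmannCurvature.IsNondegeneratePoint h p)
    (t t₁ t₂ : V →L[K] V)
    (ht : t ∈ GrassmannCurvature.tangentSpace h p)
    (ht₁ : t₁ ∈ GrassmannCurvature.tangentSpace h p)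
    (ht₂ : t₂ ∈ GrassmannCurvature.tangentSpace h p) :
    (∃ (U : Set (P →L[K] V)) (X₁ X₂ X : (P →L[K] V) → (V →L[K] V)),
      GrassmannCurvature.IsSaturatedNondegenerate h U ∧ p ∈ U ∧
      GrassmannCurvature.IsLiftedField h U X₁ ∧ GrassmannCurvature.IsLiftedField h U X₂ ∧
      GrassmannCurvature.IsLiftedField h U X ∧ X₁ p = t₁ ∧ X₂ p = t₂ ∧ X p = t) ∧
    ∀ (U : Set (P →L[K] V)) (X₁ X₂ X : (P →L[K] V) → (V →L[K] V)),
      GrassmannCurvature.IsSaturatedNondegenerate h U → p ∈ U →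
      GrassmannCurvature.IsLiftedField h U X₁ → GrassmannCurvature.IsLiftedField h U X₂ →
      GrassmannCurvature.IsLiftedField h U X → X₁ p = t₁ → X₂ p = t₂ → X p = t →
      GrassmannCurvature.curvature h X₁ X₂ X p =
        t ∘L GrassmannCurvature.adjoint h t₁ ∘L t₂
          + t₂ ∘L GrassmannCurvature.adjoint h t₁ ∘L t
          - t ∘L GrassmannCurvature.adjoint h t₂ ∘L t₁
          - t₁ ∘L GrassmannCurvature.adjoint h t₂ ∘L t := by
  refine ⟨⟨_, _, _, _, GrassmannCurvature.isSaturatedNondegenerate_setOf hsymm hnondeg, hp,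
    GrassmannCurvature.isLiftedField_tangentPart hsymm hnondeg t₁,
    GrassmannCurvature.isLiftedField_tangentPart hsymm hnondeg t₂,
    GrassmannCurvature.isLiftedField_tangentPart hsymm hnondeg t,
    GrassmannCurvature.tangentPart_eq_of_mem hp ht₁,
    GrassmannCurvature.tangentPart_eq_of_mem hp ht₂,
    GrassmannCurvature.tangentPart_eq_of_mem hp ht⟩, ?_⟩
  rintro U X₁ X₂ X hU hpU hX₁ hX₂ hX rfl rfl rfl
  exact GrassmannCurvature.curvature_eq hU hpU hsymm hnondeg hX hX₁ hX₂
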